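/- Let $\mathbb{A}$ be the ring of adeles of $\mathbb{Q}$, i.e. the set of all $\alpha=(\alpha_\infty,\alpha_2,\alpha_3,\alpha_5,\ldots)\in\mathbb{R}\times\prod_p\mathbb{Q}_p$ with $\alpha_p\in\mathbb{Z}_p$ for all but finitely many primes $p$, with the restricted product topology. Embed $\mathbb{Q}$ diagonally in $\mathbb{A}$, let $X=\mathbb{A}/\mathbb{Q}$ be the (compact) quotient group, and let $|\cdot|$ denote Haar probability measure on the Borel sets of $X$. For $\alpha\in X$ let $T_\alpha:X\to X$ be the rotation $T_\alpha(x)=x+\alpha$. A bounded remainder set for $T_\alpha$ is a finite multiset sum $A=A_1+\cdots+A_k$ of measurable sets $A_i\subseteq X$, with $\chi_A=\sum_{i=1}^k\chi_{A_i}$ and volume $|A|=\sum_{i=1}^k|A_i|$, for which there is a constant $C=C(A)>0$ such that, for almost every $x\in X$ and for every $N\in\mathbb{N}$, $$\left|\sum_{n=0}^{N-1}\chi_A(x+n\alpha)-N|A|\right|\le C.$$ For $x=\sum_{i\ge -N}b_ip^i\in\mathbb{Q}_p$ with $N\ge 0$ and $b_i\in\{0,1,\ldots,p-1\}$, let $\{x\}_p=\sum_{i=-N}^{-1}b_ip^i\in\mathbb{Q}$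 be its $p$-adic fractional part. Theorem. Let $\alpha\in X$ be represented by $(\alpha_\infty,\alpha_2,\alpha_3,\ldots)\in\mathbb{A}$, and suppose that $\alpha_\infty\notin\mathbb{Q}$. Then the set of all volumes of bounded remainder sets for $T_\alpha$ is $$\left\{-\gamma\alpha_\infty+\sum_p\{\gamma\alpha_p\}_p+n\ge 0:\gamma\in\mathbb{Q},\ n\in\mathbb{Z}\right\},$$ where the sum runs over all primes $p$ and has only finitely many nonzero terms. -/

import Mathlib

open MeasureTheory TopologicalSpace Set
open scoped RestrictedProduct

/-! ### General notions: rotations and bounded remainder sets -/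

section BoundedRemainder

variable {G : Type*} [AddCommGroup G] [MeasurableSpace G]

/-- The rotation `T_α : x ↦ x + α`. -/
def rotationBy (α : G) : G → G := fun x => x + α

/-- The counting function `χ_A` of the multiset `A = A₁ + ⋯ + A_k`: the sum of the indicator
functions of the sets `A i`. -/
noncomputable def multisetIndicator {k : ℕ} (A : Fin k → Set G) (x : G) : ℝ :=
  ∑ i, (A i).indicator (fun _ => (1 : ℝ)) x

/-- The volume `|A|` of a multiset: each set is counted with its multiplicity. -/
noncomputable def multisetVolume (μ : Measure G) {k : ℕ} (A : Fin k → Set G) : ℝ :=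
  ∑ i, μ.real (A i)

/-- The multiset `A` (a finite sum of measurable sets) is a bounded remainder set for the rotation
`T_α`: the discrepancies of almost every orbit are bounded by a constant depending only on `A`
(for the given rotation). Here `T_α^n x = x + n α`. -/
def IsBoundedRemainderSet (μ : Measure G) (α : G) {k : ℕ} (A : Fin k → Set G) : Prop :=
  (∀ i, MeasurableSet (A i)) ∧
    ∃ C : ℝ, 0 < C ∧ ∀ᵐ x ∂μ, ∀ N : ℕ,
      |∑ n ∈ Finset.range N, multisetIndicator A ((rotationBy α)^[n] x) - N * multisetVolume μ A| ≤ C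

/-- The set of all volumes of bounded remainder sets for the rotation `T_α`. -/
def boundedRemainderVolumes (μ : Measure G) (α : G) : Set ℝ :=
  {v | ∃ (k : ℕ) (A : Fin k → Set G), IsBoundedRemainderSet μ α A ∧ multisetVolume μ A = v}

end BoundedRemainder

/-! ### The `p`-adic fractional part -/

theorem padic_norm_mul_pow_le_one (p : ℕ) [Fact p.Prime] (x : ℚ_[p]) :
    ‖x * (p : ℚ_[p]) ^ (-x.valuation).toNat‖ ≤ 1 := by
  have hp : (1 : ℝ) < p := by exact_mod_cast (Fact.out : p.Prime).one_lt
  by_cases hx : x = 0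
  · simp [hx]
  rw [norm_mul, norm_pow, Padic.norm_p, Padic.norm_eq_zpow_neg_valuation hx, inv_pow,
    ← zpow_natCast, ← zpow_neg, ← zpow_add₀ (by positivity)]
  apply zpow_le_one_of_nonpos₀ hp.le
  have := Int.self_le_toNat (-x.valuation)
  linarith

/-- The `p`-adic fractional part `{x}_p = ∑_{-N ≤ i < 0} b_i p^i` of
`x = ∑_{i ≥ -N} b_i p^i`, with digits `0 ≤ b_i < p`. For `N = max (0, -v_p(x))` the number
`x p^N` is a `p`-adic integer, and `PadicInt.appr z N` is the sum of the first `N` terms of the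
`p`-adic expansion of `z`, i.e. the natural number below `p^N` that is congruent to `z`
modulo `p^N`. See `padicFract_eq_of_expansion`. -/
noncomputable def padicFract (p : ℕ) [Fact p.Prime] (x : ℚ_[p]) : ℚ :=
  (PadicInt.appr ⟨x * (p : ℚ_[p]) ^ (-x.valuation).toNat, padic_norm_mul_pow_le_one p x⟩
    (-x.valuation).toNat : ℚ) / (p : ℚ) ^ (-x.valuation).toNat

theorem padicFract_spec (p : ℕ) [Fact p.Prime] (x : ℚ_[p]) :
    (∃ N m : ℕ, m < p ^ N ∧ padicFract p x = (m : ℚ) / (p : ℚ) ^ N) ∧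
      ‖x - (padicFract p x : ℚ_[p])‖ ≤ 1 := by
  refine ⟨⟨_, _, PadicInt.appr_lt _ _, rfl⟩, ?_⟩
  have hp0 : (p : ℚ_[p]) ≠ 0 := by exact_mod_cast (Fact.out : p.Prime).ne_zero
  have key : ∀ (N : ℕ) (z : ℤ_[p]), (z : ℚ_[p]) = x * (p : ℚ_[p]) ^ N →
      ‖x - (((z.appr N : ℚ) / (p : ℚ) ^ N : ℚ) : ℚ_[p])‖ ≤ 1 := by
    intro N z hz
    obtain ⟨c, hc⟩ := Ideal.mem_span_singleton.mp (PadicInt.appr_spec N z)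
    have h : (z : ℚ_[p]) - (z.appr N : ℚ_[p]) = (p : ℚ_[p]) ^ N * c := by
      have h := congrArg (fun z : ℤ_[p] => (z : ℚ_[p])) hc
      push_cast at h
      exact h
    push_cast
    rw [show x - (z.appr N : ℚ_[p]) / (p : ℚ_[p]) ^ N = c by
      field_simp
      linear_combination h - hz]
    exact c.2
  exact key _ _ rfl

theorem padicFract_unique (p : ℕ) [Fact p.Prime] (x : ℚ_[p]) (N m : ℕ) (hm : m < p ^ N)
    (h : ‖x - (m : ℚ_[p]) / (p : ℚ_[p]) ^ N‖ ≤ 1) : padicFract p x = (m : ℚ) / (p : ℚ) ^ N := by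
  have hp : (p : ℚ) ≠ 0 := by exact_mod_cast (Fact.out : p.Prime).ne_zero
  have hp0 : (p : ℚ_[p]) ≠ 0 := by exact_mod_cast (Fact.out : p.Prime).ne_zero
  obtain ⟨⟨M, a, ha, hfa⟩, hf⟩ := padicFract_spec p x
  rw [hfa] at hf ⊢
  push_cast at hf
  have h1 : ‖(a : ℚ_[p]) / (p : ℚ_[p]) ^ M - (m : ℚ_[p]) / (p : ℚ_[p]) ^ N‖ ≤ 1 := by
    have := (PadicInt.subring p).sub_mem (show _ ∈ PadicInt.subring p from h)
      (show _ ∈ PadicInt.subring p from hf)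
    rw [sub_sub_sub_cancel_left] at this
    exact this
  have h2 : ‖(((a : ℤ) * (p : ℤ) ^ N - m * (p : ℤ) ^ M : ℤ) : ℚ_[p])‖
      ≤ (p : ℝ) ^ (-((M + N : ℕ) : ℤ)) := by
    have : (((a : ℤ) * (p : ℤ) ^ N - m * (p : ℤ) ^ M : ℤ) : ℚ_[p]) =
        ((a : ℚ_[p]) / (p : ℚ_[p]) ^ M - (m : ℚ_[p]) / (p : ℚ_[p]) ^ N)
          * (p : ℚ_[p]) ^ (M + N) := by
      push_cast
      field_simp
      ring
    rw [this, norm_mul, norm_pow, Padic.norm_p, zpow_neg, zpow_natCast, inv_pow]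
    exact mul_le_of_le_one_left (by positivity) h1
  rw [Padic.norm_int_le_pow_iff_dvd] at h2
  have h3 : (a : ℤ) * (p : ℤ) ^ N - m * (p : ℤ) ^ M = 0 := by
    refine Int.eq_zero_of_abs_lt_dvd h2 ?_
    have ha' : (a : ℤ) < (p : ℤ) ^ M := by exact_mod_cast ha
    have hm' : (m : ℤ) < (p : ℤ) ^ N := by exact_mod_cast hm
    have hM : (0 : ℤ) < (p : ℤ) ^ M := by
      have := (Fact.out : p.Prime).pos
      positivity
    have hN : (0 : ℤ) < (p : ℤ) ^ N := by
      have := (Fact.out : p.Prime).pos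
      positivity
    rw [pow_add, abs_lt]
    constructor <;> nlinarith [Int.natCast_nonneg a, Int.natCast_nonneg m]
  rw [div_eq_div_iff (by positivity) (by positivity)]
  exact_mod_cast sub_eq_zero.mp h3

/-- The fractional part is the sum of the terms of negative index of the `p`-adic expansion. -/
theorem padicFract_eq_of_expansion (p : ℕ) [Fact p.Prime] (N : ℕ) (b : ℕ → ℕ)
    (hb : ∀ i, b i < p) (z : ℤ_[p]) (x : ℚ_[p])
    (hx : x = ∑ i ∈ Finset.range N, (b i : ℚ_[p]) * (p : ℚ_[p]) ^ ((i : ℤ) - N) + z) :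
    padicFract p x = ∑ i ∈ Finset.range N, (b i : ℚ) * (p : ℚ) ^ ((i : ℤ) - N) := by
  have hp : (p : ℚ) ≠ 0 := by exact_mod_cast (Fact.out : p.Prime).ne_zero
  have hp0 : (p : ℚ_[p]) ≠ 0 := by exact_mod_cast (Fact.out : p.Prime).ne_zero
  have hlt : ∀ n : ℕ, ∑ i ∈ Finset.range n, b i * p ^ i < p ^ n := by
    intro n
    induction n with
    | zero => simp
    | succ n ih =>
      rw [Finset.sum_range_succ, pow_succ]
      have := Nat.mul_le_mul_right (p ^ n) (Nat.succ_le_of_lt (hb n))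
      rw [Nat.succ_mul] at this
      linarith [mul_comm p (p ^ n)]
  have key := padicFract_unique p x N (∑ i ∈ Finset.range N, b i * p ^ i) (hlt N) ?_
  · rw [key]
    push_cast
    rw [Finset.sum_div]
    refine Finset.sum_congr rfl fun i _ => ?_
    rw [zpow_sub₀ hp, zpow_natCast, zpow_natCast, mul_div_assoc]
  · have : x - ((∑ i ∈ Finset.range N, b i * p ^ i : ℕ) : ℚ_[p]) / (p : ℚ_[p]) ^ N = z := by
      rw [hx]
      push_cast
      rw [Finset.sum_div, add_sub_right_comm, ← Finset.sum_sub_distrib, Finset.sum_eq_zero, zero_add]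
      intro i _
      rw [zpow_sub₀ hp0, zpow_natCast, zpow_natCast, mul_div_assoc, sub_self]
    rw [this]
    exact z.2

theorem padicFract_eq_zero (p : ℕ) [Fact p.Prime] {x : ℚ_[p]} (hx : ‖x‖ ≤ 1) :
    padicFract p x = 0 := by
  have := padicFract_unique p x 0 0 (by simp) (by simpa using hx)
  simpa using this

/-! ### The adeles of `ℚ` and the adelic torus -/

instance factPrimeOfPrimes (p : Nat.Primes) : Fact (p : ℕ).Prime := ⟨p.2⟩

/-- The finite adeles: the restricted product of the fields `ℚ_p` with respect to the `ℤ_p`. -/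
abbrev FinAdele : Type := Πʳ p : Nat.Primes, [ℚ_[(p : ℕ)], PadicInt.subring (p : ℕ)]

/-- The ring `𝔸` of adeles of `ℚ`, with the restricted product topology. -/
abbrev Adele : Type := ℝ × FinAdele

instance padicInt_isOpen_fact :
    Fact (∀ p : Nat.Primes, IsOpen (PadicInt.subring (p : ℕ) : Set ℚ_[(p : ℕ)])) := by
  refine ⟨fun p => ?_⟩
  have h := IsUltrametricDist.isOpen_closedBall (0 : ℚ_[(p : ℕ)]) one_ne_zero
  convert h using 1
  ext x
  exact mem_closedBall_zero_iff.symm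

instance padicInt_compactSpace (p : Nat.Primes) : CompactSpace (PadicInt.subring (p : ℕ)) :=
  inferInstanceAs (CompactSpace ℤ_[(p : ℕ)])

theorem finite_not_padicInt (x : FinAdele) : {p : Nat.Primes | ¬ ‖x p‖ ≤ 1}.Finite :=
  x.eventually

/-- A rational number is a `p`-adic integer for all but finitely many primes `p`. -/
theorem rat_eventually_padicInt (q : ℚ) :
    ∀ᶠ p : Nat.Primes in Filter.cofinite, (q : ℚ_[(p : ℕ)]) ∈ PadicInt.subring (p : ℕ) := by
  have hfin : {p : Nat.Primes | (p : ℕ) ∣ q.den}.Finite := by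
    have h := (Nat.divisors q.den).finite_toSet.preimage
      (f := fun p : Nat.Primes => (p : ℕ)) Subtype.val_injective.injOn
    refine h.subset fun p hp => ?_
    simpa [q.den_nz] using hp
  refine hfin.subset fun p hp => ?_
  by_contra hd
  exact hp (Padic.norm_rat_le_one hd)

/-- The diagonal embedding `ℚ → 𝔸`. -/
noncomputable def adeleDiagonal : ℚ →+ Adele where
  toFun q := ((q : ℝ), ⟨fun p => (q : ℚ_[(p : ℕ)]), rat_eventually_padicInt q⟩)
  map_zero' := by
    refine Prod.ext (by simp) (RestrictedProduct.ext _ _ fun p => ?_)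
    exact Rat.cast_zero
  map_add' x y := by
    refine Prod.ext (by simp) (RestrictedProduct.ext _ _ fun p => ?_)
    exact Rat.cast_add x y

/-- The adelic torus `𝔸 / ℚ`, with the quotient topology. -/
abbrev AdelicTorus : Type := Adele ⧸ adeleDiagonal.range

/-- The measurable sets of the adelic torus are the Borel sets. -/
noncomputable instance adelicTorusMeasurableSpace : MeasurableSpace AdelicTorus := borel AdelicTorus

instance adelicTorusBorelSpace : BorelSpace AdelicTorus := ⟨rfl⟩

theorem exists_rat_sub_integral (x : FinAdele) :
    ∃ r : ℚ, ∀ p : Nat.Primes, ‖x p - (r : ℚ_[(p : ℕ)])‖ ≤ 1 := by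
  classical
  set S := (finite_not_padicInt x).toFinset with hS
  refine ⟨∑ q ∈ S, padicFract q (x q), fun p => ?_⟩
  have hoff : ∀ q : Nat.Primes, q ≠ p → ‖((padicFract q (x q) : ℚ) : ℚ_[(p : ℕ)])‖ ≤ 1 := by
    intro q hqp
    obtain ⟨⟨N, m, -, h⟩, -⟩ := padicFract_spec q (x q)
    rw [h]
    push_cast
    have hq : ‖((q : ℕ) : ℚ_[(p : ℕ)])‖ = 1 := by
      rw [Padic.norm_natCast_eq_one_iff]
      exact (Nat.coprime_primes p.2 q.2).mpr fun h => hqp (Subtype.ext h.symm)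
    rw [norm_div, norm_pow, hq, one_pow, div_one]
    simpa using Padic.norm_int_le_one (p := (p : ℕ)) (m : ℤ)
  have hsum : ∀ T : Finset Nat.Primes, (∀ q ∈ T, q ≠ p) →
      ‖((∑ q ∈ T, padicFract q (x q) : ℚ) : ℚ_[(p : ℕ)])‖ ≤ 1 := by
    intro T hT
    have : ((∑ q ∈ T, padicFract q (x q) : ℚ) : ℚ_[(p : ℕ)]) ∈ PadicInt.subring (p : ℕ) := by
      push_cast
      exact Subring.sum_mem _ fun q hq => hoff q (hT q hq)
    exact this
  by_cases hp : p ∈ S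
  · rw [← Finset.add_sum_erase S _ hp]
    push_cast
    rw [← sub_sub]
    have h := hsum (S.erase p) fun q hq => Finset.ne_of_mem_erase hq
    push_cast at h
    exact (PadicInt.subring (p : ℕ)).sub_mem (padicFract_spec p (x p)).2 h
  · have hx : ‖x p‖ ≤ 1 := by
      by_contra hx
      exact hp (by simpa [hS] using hx)
    exact (PadicInt.subring (p : ℕ)).sub_mem hx
      (hsum S fun q hq hqp => hp (hqp ▸ hq))

/-- The adelic torus is compact, being the image of `[0, 1] × ∏ ℤ_p`. -/
instance adelicTorusCompactSpace : CompactSpace AdelicTorus := by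
  let f : ℝ × (∀ p : Nat.Primes, PadicInt.subring (p : ℕ)) → AdelicTorus := fun y =>
    QuotientAddGroup.mk ((y.1, RestrictedProduct.structureMap _ _ _ y.2) : Adele)
  have hf : Continuous f := continuous_quotient_mk'.comp
    (continuous_fst.prodMk (RestrictedProduct.isEmbedding_structureMap.continuous.comp
      continuous_snd))
  have hK : IsCompact (f '' (Icc 0 1 ×ˢ univ)) := (isCompact_Icc.prod isCompact_univ).image hf
  refine ⟨?_⟩
  convert hK
  refine (eq_univ_of_forall fun y => ?_).symm
  obtain ⟨a, rfl⟩ := QuotientAddGroup.mk_surjective y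
  obtain ⟨r, hr⟩ := exists_rat_sub_integral a.2
  set n : ℤ := ⌊a.1 - r⌋ with hn
  have hmem : ∀ p : Nat.Primes,
      a.2 p - ((r + n : ℚ) : ℚ_[(p : ℕ)]) ∈ PadicInt.subring (p : ℕ) := by
    intro p
    push_cast
    rw [← sub_sub]
    exact (PadicInt.subring (p : ℕ)).sub_mem (hr p) (Padic.norm_int_le_one n)
  refine ⟨(a.1 - ((r + n : ℚ) : ℝ), fun p => ⟨_, hmem p⟩), ⟨⟨?_, ?_⟩, mem_univ _⟩, ?_⟩
  · push_cast
    linarith [Int.floor_le (a.1 - r)]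
  · push_cast
    linarith [Int.lt_floor_add_one (a.1 - r)]
  · refine (QuotientAddGroup.eq.mpr ⟨r + n, ?_⟩)
    refine Prod.ext ?_ (RestrictedProduct.ext _ _ fun p => ?_)
    · change ((r + n : ℚ) : ℝ) = -(a.1 - ((r + n : ℚ) : ℝ)) + a.1
      ring
    · change ((r + n : ℚ) : ℚ_[(p : ℕ)]) = -(a.2 p - ((r + n : ℚ) : ℚ_[(p : ℕ)])) + a.2 p
      ring

/-- The Haar probability measure on the adelic torus: the Haar measure that gives the whole
compact group measure `1`. -/
noncomputable def adelicHaar : Measure AdelicTorus :=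
  Measure.addHaarMeasure (⊤ : PositiveCompacts AdelicTorus)

/-! If the discrepancies of `A` are bounded, then `χ_A - |A|` is a coboundary `g - g ∘ T_α`. As
`χ_A` takes integer values, `exp (2πig)` is then an eigenfunction of the Koopman operator of `T_α`
with eigenvalue `exp (2πi|A|)`. Conversely, lift an eigenfunction with eigenvalue `exp (2πiv)`,
`v ≥ 0`, to a function `g` with values in `[0, 1)`. Then `v + g - g ∘ T_α` is bounded, takes values
in `ℕ` and has integral `v`, so it is the counting function of a bounded remainder set of volume
`v`. On a compact group, a group of characters that separates points spans a dense subspace of `L²`,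
so that the eigenvalues of `T_α` are the numbers `ψ(α)` with `ψ` in this group. On `𝔸 / ℚ` the
characters `x ↦ exp (2πi(-γ x_∞ + ∑ {γ x_p}_p))` with `γ ∈ ℚ` form such a group. -/

section Circle

theorem unitAddCircle_coe_eq_zero_iff {x : ℝ} :
    (x : UnitAddCircle) = 0 ↔ ∃ n : ℤ, x = n := by
  simp only [AddCircle.coe_eq_zero_iff, zsmul_eq_mul, mul_one, eq_comm (a := x)]

theorem unitAddCircle_coe_eq_coe_iff {x y : ℝ} :
    (x : UnitAddCircle) = (y : UnitAddCircle) ↔ ∃ n : ℤ, x = y + n := by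
  rw [← sub_eq_zero, ← AddCircle.coe_sub, unitAddCircle_coe_eq_zero_iff]
  simp only [sub_eq_iff_eq_add']

theorem exists_nat_eq_of_unitAddCircle_coe_eq_zero {t : ℝ} {k : ℕ}
    (ht : (t : UnitAddCircle) = 0) (hlt : -1 < t) (htk : t < k + 1) : ∃ m ≤ k, t = (m : ℝ) := by
  obtain ⟨n, rfl⟩ := unitAddCircle_coe_eq_zero_iff.mp ht
  have hn : -1 < n := by exact_mod_cast hlt
  have hnk : n < k + 1 := by exact_mod_cast htk
  lift n to ℕ using by lia
  exact ⟨n, by lia, Int.cast_natCast n⟩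

theorem continuous_coe_toCircle :
    Continuous fun θ : UnitAddCircle => (AddCircle.toCircle θ : ℂ) :=
  continuous_induced_dom.comp AddCircle.continuous_toCircle

theorem exists_measurable_lift_Ico {X : Type*} [MeasurableSpace X] {u : X → UnitAddCircle}
    (hu : Measurable u) :
    ∃ g : X → ℝ, Measurable g ∧ (∀ x, g x ∈ Ico 0 1) ∧ ∀ x, (g x : UnitAddCircle) = u x := by
  refine ⟨fun x => AddCircle.measurableEquivIco 1 0 (u x),
    measurable_subtype_coe.comp ((AddCircle.measurableEquivIco 1 0).measurable.comp hu),
    fun x => ?_, fun x => AddCircle.coe_equivIco⟩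
  simpa only [zero_add] using (AddCircle.measurableEquivIco 1 0 (u x)).2

end Circle

section Cocycle

variable {X : Type*} [MeasurableSpace X] {μ : Measure X} {T : X → X} {φ g : X → ℝ}

theorem ae_birkhoffSum_eq_sub (hT : Measure.QuasiMeasurePreserving T μ μ)
    (h : ∀ᵐ x ∂μ, φ x = g x - g (T x)) :
    ∀ᵐ x ∂μ, ∀ N : ℕ, birkhoffSum T φ N x = g x - g (T^[N] x) := by
  filter_upwards [ae_all_iff.mpr fun n => (hT.iterate n).ae h] with x hx N
  induction N with
  | zero => simp
  | succ N ih =>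
    rw [birkhoffSum_succ, ih, hx, Function.iterate_succ_apply', sub_add_sub_cancel]

-- The transfer function is `g = limsup S_N`, since `S_{N+1} = φ + S_N ∘ T`.
theorem exists_measurable_coboundary_of_birkhoffSum_bounded
    (hT : Measure.QuasiMeasurePreserving T μ μ) (hφ : Measurable φ) {C : ℝ}
    (hC : ∀ᵐ x ∂μ, ∀ N : ℕ, |birkhoffSum T φ N x| ≤ C) :
    ∃ g : X → ℝ, Measurable g ∧ ∀ᵐ x ∂μ, φ x = g x - g (T x) := by
  have hS : ∀ N, Measurable (birkhoffSum T φ N) := fun N =>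
    Finset.measurable_fun_sum _ fun n _ => hφ.comp (hT.measurable.iterate n)
  refine ⟨fun x => Filter.limsup (fun N => birkhoffSum T φ N x) Filter.atTop,
    Measurable.limsup hS, ?_⟩
  filter_upwards [hT.ae hC] with x hx
  have hle : Filter.atTop.IsBoundedUnder (· ≤ ·) fun N => birkhoffSum T φ N (T x) :=
    Filter.isBoundedUnder_of ⟨C, fun N => (abs_le.mp (hx N)).2⟩
  have hge : Filter.atTop.IsBoundedUnder (· ≥ ·) fun N => birkhoffSum T φ N (T x) :=
    Filter.isBoundedUnder_of ⟨-C, fun N => (abs_le.mp (hx N)).1⟩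
  rw [eq_sub_iff_add_eq, ← limsup_const_add _ _ _ hle hge.isCoboundedUnder_le,
    ← Filter.limsup_nat_add (fun N => birkhoffSum T φ N x) 1]
  simp only [birkhoffSum_succ']

/-- `exp (2πiθ)` is an eigenvalue of the Koopman operator `f ↦ f ∘ T`, with a measurable
eigenfunction `exp (2πiu)` of absolute value `1`. The exponents `θ` and `u` are recorded instead of
the complex numbers. -/
def IsUnimodularEigenvalue (μ : Measure X) (T : X → X) (θ : UnitAddCircle) : Prop :=
  ∃ u : X → UnitAddCircle, Measurable u ∧ ∀ᵐ x ∂μ, u (T x) = u x + θ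

theorem integral_toCircle_eq_zero (hT : MeasurePreserving T μ μ) {w : X → UnitAddCircle}
    (hw : Measurable w) {c : UnitAddCircle} (hc : c ≠ 0) (h : ∀ᵐ x ∂μ, w (T x) = w x + c) :
    ∫ x, (AddCircle.toCircle (w x) : ℂ) ∂μ = 0 := by
  have hmeas : Measurable fun x => (AddCircle.toCircle (w x) : ℂ) :=
    continuous_coe_toCircle.measurable.comp hw
  have hmul : ∫ x, (AddCircle.toCircle (w x) : ℂ) ∂μ =
      (∫ x, (AddCircle.toCircle (w x) : ℂ) ∂μ) * AddCircle.toCircle c :=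
    calc
      _ = ∫ x, (AddCircle.toCircle (w (T x)) : ℂ) ∂μ := by
        conv_lhs => rw [← hT.map_eq]
        exact integral_map hT.measurable.aemeasurable hmeas.aestronglyMeasurable
      _ = ∫ x, (AddCircle.toCircle (w x) : ℂ) * AddCircle.toCircle c ∂μ := by
        refine integral_congr_ae (h.mono fun x hx => ?_)
        simp only [hx, AddCircle.toCircle_add, Circle.coe_mul]
      _ = _ := integral_mul_const _ _
  have hne : (AddCircle.toCircle c : ℂ) ≠ 1 := fun h1 => hc <|
    AddCircle.injective_toCircle one_ne_zero (AddCircle.toCircle_zero.symm ▸ Subtype.ext h1)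
  by_contra hI
  exact hne (mul_left_cancel₀ hI (hmul.symm.trans (mul_one _).symm))

end Cocycle

section Multiset

variable {G : Type*} {k : ℕ}

theorem multisetIndicator_superlevel {F : G → ℝ} {x : G} {m : ℕ} (hm : m ≤ k) (hx : F x = m) :
    multisetIndicator (fun i : Fin k => {y | ((i : ℕ) : ℝ) < F y}) x = m := by
  simp only [multisetIndicator, indicator_apply, mem_ofPred_eq, hx, Nat.cast_lt]
  rw [Fin.sum_univ_eq_sum_range (fun i => if i < m then (1 : ℝ) else 0) k, Finset.sum_boole]
  congr 1
  rw [show {i ∈ Finset.range k | i < m} = Finset.range m by grind, Finset.card_range]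

theorem exists_nat_multisetIndicator_eq (A : Fin k → Set G) (x : G) :
    ∃ n : ℕ, multisetIndicator A x = n := by
  classical
  exact ⟨∑ i, if x ∈ A i then 1 else 0, by simp [multisetIndicator, indicator_apply]⟩

variable [MeasurableSpace G] {A : Fin k → Set G}

theorem measurable_multisetIndicator (hA : ∀ i, MeasurableSet (A i)) :
    Measurable (multisetIndicator A) :=
  Finset.measurable_fun_sum _ fun i _ => measurable_const.indicator (hA i)

theorem multisetVolume_eq_integral (μ : Measure G) [IsFiniteMeasure μ]
    (hA : ∀ i, MeasurableSet (A i)) :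
    multisetVolume μ A = ∫ x, multisetIndicator A x ∂μ := by
  unfold multisetVolume multisetIndicator
  rw [integral_finsetSum _ fun i _ => (integrable_const _).indicator (hA i)]
  simp [integral_indicator_const, hA]

end Multiset

section Eigenvalue

variable {G : Type*} [AddCommGroup G] [MeasurableSpace G] {μ : Measure G} {α : G} {k : ℕ}
  {A : Fin k → Set G}

theorem isBoundedRemainderSet_iff_birkhoffSum :
    IsBoundedRemainderSet μ α A ↔
      (∀ i, MeasurableSet (A i)) ∧ ∃ C : ℝ, 0 < C ∧ ∀ᵐ x ∂μ, ∀ N : ℕ,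
        |birkhoffSum (rotationBy α) (fun y => multisetIndicator A y - multisetVolume μ A) N x|
          ≤ C := by
  simp only [IsBoundedRemainderSet, birkhoffSum, Finset.sum_sub_distrib, Finset.sum_const,
    Finset.card_range, nsmul_eq_mul]

variable [MeasurableAdd G] [μ.IsAddRightInvariant]

variable (μ α) in
theorem measurePreserving_rotationBy : MeasurePreserving (rotationBy α) μ μ :=
  measurePreserving_add_right μ α

-- Modulo `ℤ`, the coboundary equation `χ_A - |A| = g - g ∘ T_α` says that `g` is an eigenfunction.
theorem IsBoundedRemainderSet.isUnimodularEigenvalue (h : IsBoundedRemainderSet μ α A) :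
    IsUnimodularEigenvalue μ (rotationBy α) (multisetVolume μ A : UnitAddCircle) := by
  obtain ⟨hA, C, -, hC⟩ := isBoundedRemainderSet_iff_birkhoffSum.mp h
  obtain ⟨g, hg, hgA⟩ := exists_measurable_coboundary_of_birkhoffSum_bounded
    (measurePreserving_rotationBy μ α).quasiMeasurePreserving
    ((measurable_multisetIndicator hA).sub_const _) hC
  refine ⟨fun x => g x, AddCircle.measurable_mk'.comp hg, ?_⟩
  filter_upwards [hgA] with x hx
  obtain ⟨n, hn⟩ := exists_nat_multisetIndicator_eq A x
  rw [← AddCircle.coe_add, unitAddCircle_coe_eq_coe_iff]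
  refine ⟨-n, ?_⟩
  push_cast
  linarith

variable [IsProbabilityMeasure μ]

theorem multisetVolume_eq_of_ae_coboundary (hA : ∀ i, MeasurableSet (A i)) {v : ℝ} {g : G → ℝ}
    (hg : Integrable g μ)
    (h : ∀ᵐ x ∂μ, multisetIndicator A x = v + (g x - g (rotationBy α x))) :
    multisetVolume μ A = v := by
  have hgT : Integrable (fun x => g (rotationBy α x)) μ := hg.comp_add_right α
  have hcob : Integrable (fun x => g x - g (rotationBy α x)) μ := hg.sub hgT
  have hinv : ∫ x, g (rotationBy α x) ∂μ = ∫ x, g x ∂μ := integral_add_right_eq_self g α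
  rw [multisetVolume_eq_integral μ hA, integral_congr_ae h,
    integral_add (integrable_const v) hcob, integral_sub hg hgT, hinv, sub_self, add_zero,
    integral_const, probReal_univ, one_smul]

theorem mem_boundedRemainderVolumes_of_ae_coboundary (hA : ∀ i, MeasurableSet (A i)) {v : ℝ}
    {g : G → ℝ} (hg : Measurable g) (hg01 : ∀ x, g x ∈ Ico 0 1)
    (h : ∀ᵐ x ∂μ, multisetIndicator A x = v + (g x - g (rotationBy α x))) :
    v ∈ boundedRemainderVolumes μ α := by
  have hgi : Integrable g μ := Integrable.of_bound hg.aestronglyMeasurable 1 <| .of_forall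
    fun x => abs_le.mpr ⟨by linarith [(hg01 x).1], (hg01 x).2.le⟩
  have hvol : multisetVolume μ A = v := multisetVolume_eq_of_ae_coboundary hA hgi h
  refine ⟨k, A, isBoundedRemainderSet_iff_birkhoffSum.mpr ⟨hA, 1, one_pos, ?_⟩, hvol⟩
  filter_upwards [ae_birkhoffSum_eq_sub
    (measurePreserving_rotationBy μ α).quasiMeasurePreserving
    (h.mono fun x hx => show multisetIndicator A x - multisetVolume μ A = _ by
      rw [hx, hvol, add_sub_cancel_left])] with x hx N
  rw [hx N]
  exact (abs_sub_lt_of_nonneg_of_lt (hg01 _).1 (hg01 _).2 (hg01 _).1 (hg01 _).2).le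

-- If `g` lifts the eigenfunction to `[0, 1)`, then `v + g - g ∘ T_α` is a counting function.
theorem mem_boundedRemainderVolumes_of_isUnimodularEigenvalue {v : ℝ} (hv : 0 ≤ v)
    (h : IsUnimodularEigenvalue μ (rotationBy α) (v : UnitAddCircle)) :
    v ∈ boundedRemainderVolumes μ α := by
  obtain ⟨u, hu, huT⟩ := h
  obtain ⟨g, hg, hg01, hgu⟩ := exists_measurable_lift_Ico hu
  set F : G → ℝ := fun x => v + (g x - g (rotationBy α x)) with hF
  have hFm : Measurable F :=
    (hg.sub (hg.comp (measurePreserving_rotationBy μ α).measurable)).const_add v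
  refine mem_boundedRemainderVolumes_of_ae_coboundary
    (A := fun i : Fin (⌊v⌋₊ + 1) => {x | ((i : ℕ) : ℝ) < F x})
    (fun i => measurableSet_lt measurable_const hFm) hg hg01 ?_
  filter_upwards [huT] with x hx
  have hF0 : (F x : UnitAddCircle) = 0 := by
    rw [hF, AddCircle.coe_add, AddCircle.coe_sub, hgu, hgu, hx]
    abel
  obtain ⟨hx0, hx1⟩ := hg01 x
  obtain ⟨hTx0, hTx1⟩ := hg01 (rotationBy α x)
  obtain ⟨m, hm, hFx⟩ := exists_nat_eq_of_unitAddCircle_coe_eq_zero (k := ⌊v⌋₊ + 1) hF0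
    (by linarith) (by push_cast; linarith [Nat.lt_floor_add_one v])
  exact (multisetIndicator_superlevel hm hFx).trans hFx.symm

theorem mem_boundedRemainderVolumes_iff_isUnimodularEigenvalue {v : ℝ} :
    v ∈ boundedRemainderVolumes μ α ↔
      0 ≤ v ∧ IsUnimodularEigenvalue μ (rotationBy α) (v : UnitAddCircle) := by
  refine ⟨?_, fun h => mem_boundedRemainderVolumes_of_isUnimodularEigenvalue h.1 h.2⟩
  rintro ⟨k, A, hA, rfl⟩
  exact ⟨Finset.sum_nonneg fun i _ => measureReal_nonneg, hA.isUnimodularEigenvalue⟩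

end Eigenvalue

section Characters

variable {G : Type*} [AddCommGroup G] [TopologicalSpace G]

/-- The character `ψ : G → ℝ/ℤ` as the continuous function `exp (2πiψ)`. -/
noncomputable def characterFun (ψ : G →ₜ+ UnitAddCircle) : C(G, ℂ) where
  toFun x := (AddCircle.toCircle (ψ x) : Circle)
  continuous_toFun := continuous_coe_toCircle.comp (map_continuous ψ)

theorem characterFun_zero : characterFun (0 : G →ₜ+ UnitAddCircle) = 1 := by
  ext
  exact congrArg Subtype.val (AddCircle.toCircle_zero (T := 1))

theorem characterFun_add (ψ χ : G →ₜ+ UnitAddCircle) :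
    characterFun (ψ + χ) = characterFun ψ * characterFun χ := by
  ext x
  exact congrArg Subtype.val (AddCircle.toCircle_add (ψ x) (χ x))

theorem characterFun_neg (ψ : G →ₜ+ UnitAddCircle) :
    characterFun (-ψ) = star (characterFun ψ) := by
  ext x
  exact (congrArg Subtype.val (AddCircle.toCircle_neg (ψ x))).trans (Circle.coe_inv_eq_conj _)

/-- The trigonometric polynomials with frequencies in `Γ`: the star subalgebra of `C(G, ℂ)`
generated by the characters in `Γ`. -/
noncomputable def characterSubalgebra (Γ : AddSubgroup (G →ₜ+ UnitAddCircle)) :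
    StarSubalgebra ℂ C(G, ℂ) where
  toSubalgebra := Algebra.adjoin ℂ (characterFun '' Γ)
  star_mem' := by
    change Algebra.adjoin ℂ (characterFun '' (Γ : Set (G →ₜ+ UnitAddCircle))) ≤
      star (Algebra.adjoin ℂ (characterFun '' (Γ : Set (G →ₜ+ UnitAddCircle))))
    refine Algebra.adjoin_le ?_
    rintro - ⟨ψ, hψ, rfl⟩
    exact Algebra.subset_adjoin ⟨-ψ, Γ.neg_mem hψ, characterFun_neg ψ⟩

variable {Γ : AddSubgroup (G →ₜ+ UnitAddCircle)}

theorem characterSubalgebra_toSubmodule :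
    Subalgebra.toSubmodule (characterSubalgebra Γ).toSubalgebra =
      Submodule.span ℂ (characterFun '' Γ) := by
  apply Algebra.adjoin_eq_span_of_subset
  refine Subset.trans (fun f hf => ?_) Submodule.subset_span
  refine Submonoid.closure_induction (fun _ => id) ⟨0, Γ.zero_mem, characterFun_zero⟩ ?_ hf
  rintro - - - - ⟨ψ, hψ, rfl⟩ ⟨χ, hχ, rfl⟩
  exact ⟨ψ + χ, Γ.add_mem hψ hχ, characterFun_add ψ χ⟩

theorem characterSubalgebra_separatesPoints (hΓ : ∀ x : G, (∀ ψ ∈ Γ, ψ x = 0) → x = 0) :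
    (characterSubalgebra Γ).SeparatesPoints := by
  intro x y hxy
  obtain ⟨ψ, hψ, hne⟩ : ∃ ψ ∈ Γ, ψ (x - y) ≠ 0 := by
    by_contra! hall
    exact hxy (sub_eq_zero.mp (hΓ _ hall))
  refine ⟨_, ⟨characterFun ψ, Algebra.subset_adjoin ⟨ψ, hψ, rfl⟩, rfl⟩, fun heq => hne ?_⟩
  rw [map_sub, sub_eq_zero]
  exact AddCircle.injective_toCircle one_ne_zero (Subtype.ext heq)

variable [CompactSpace G]

theorem span_characterFun_closure_eq_top (hΓ : ∀ x : G, (∀ ψ ∈ Γ, ψ x = 0) → x = 0) :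
    (Submodule.span ℂ (characterFun '' (Γ : Set (G →ₜ+ UnitAddCircle)))).topologicalClosure =
      ⊤ := by
  rw [← characterSubalgebra_toSubmodule]
  exact congrArg (Subalgebra.toSubmodule <| StarSubalgebra.toSubalgebra ·)
    (ContinuousMap.starSubalgebra_topologicalClosure_eq_top_of_separatesPoints _
      (characterSubalgebra_separatesPoints hΓ))

variable [MeasurableSpace G] [BorelSpace G] (μ : Measure G) [IsFiniteMeasure μ]

/-- The character `ψ` as an element of `L²(μ)`. -/
noncomputable def characterLp (ψ : G →ₜ+ UnitAddCircle) : Lp ℂ 2 μ :=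
  ContinuousMap.toLp 2 μ ℂ (characterFun ψ)

variable {μ}

theorem inner_characterLp_toLp (ψ : G →ₜ+ UnitAddCircle) {f : G → ℂ} (hf : MemLp f 2 μ) :
    inner ℂ (characterLp μ ψ) hf.toLp = ∫ x, f x * characterFun (-ψ) x ∂μ := by
  rw [L2.inner_def]
  refine integral_congr_ae ?_
  filter_upwards [hf.coeFn_toLp, ContinuousMap.coeFn_toLp (p := 2) (𝕜 := ℂ) μ (characterFun ψ)]
    with x hx hψ
  simp only [characterFun_neg, RCLike.inner_apply, characterLp, hx, hψ]
  rfl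

variable [IsTopologicalAddGroup G] [μ.WeaklyRegular]

theorem span_characterLp_closure_eq_top (hΓ : ∀ x : G, (∀ ψ ∈ Γ, ψ x = 0) → x = 0) :
    (Submodule.span ℂ (characterLp μ '' (Γ : Set (G →ₜ+ UnitAddCircle)))).topologicalClosure =
      ⊤ := by
  convert! (ContinuousMap.toLp_denseRange (p := 2) ℂ μ ℂ
    (by simp)).topologicalClosure_map_submodule (span_characterFun_closure_eq_top hΓ)
  rw [Submodule.map_span, image_image]
  rfl

theorem eq_zero_of_forall_inner_characterLp_eq_zero
    (hΓ : ∀ x : G, (∀ ψ ∈ Γ, ψ x = 0) → x = 0) {f : Lp ℂ 2 μ}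
    (hf : ∀ ψ ∈ Γ, inner ℂ (characterLp μ ψ) f = 0) : f = 0 := by
  have hdense := Submodule.topologicalClosure_eq_top_iff.mp
    (span_characterLp_closure_eq_top (μ := μ) hΓ)
  rw [← Submodule.mem_bot ℂ, ← hdense]
  refine (Submodule.mem_orthogonal _ _).mpr fun g hg => ?_
  induction hg using Submodule.span_induction with
  | mem g hg => obtain ⟨ψ, hψ, rfl⟩ := hg; exact hf ψ hψ
  | zero => exact inner_zero_left _
  | add g h _ _ hg hh => rw [inner_add_left, hg, hh, add_zero]
  | smul c g _ hg => rw [inner_smul_left, hg, mul_zero]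

-- Otherwise the eigenfunction is orthogonal to every character in `Γ`, so it vanishes.
theorem exists_character_of_isUnimodularEigenvalue [NeZero μ] [μ.IsAddRightInvariant]
    (hΓ : ∀ x : G, (∀ ψ ∈ Γ, ψ x = 0) → x = 0) {α : G} {θ : UnitAddCircle}
    (h : IsUnimodularEigenvalue μ (rotationBy α) θ) : ∃ ψ ∈ Γ, θ = ψ α := by
  obtain ⟨u, hu, huT⟩ := h
  by_contra! hne
  have hU : MemLp (fun x => (AddCircle.toCircle (u x) : ℂ)) 2 μ :=
    MemLp.of_bound (continuous_coe_toCircle.measurable.comp hu).aestronglyMeasurable 1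
      (.of_forall fun x => (Circle.norm_coe _).le)
  have horth : ∀ ψ ∈ Γ, inner ℂ (characterLp μ ψ) hU.toLp = 0 := by
    intro ψ hψ
    have hw : ∀ᵐ x ∂μ, u (rotationBy α x) - ψ (rotationBy α x) = u x - ψ x + (θ - ψ α) := by
      filter_upwards [huT] with x hx
      rw [hx, rotationBy, map_add]
      abel
    rw [inner_characterLp_toLp, ← integral_toCircle_eq_zero (measurePreserving_rotationBy μ α)
      (hu.sub (map_continuous ψ).measurable) (sub_ne_zero.mpr (hne ψ hψ)) hw]
    refine integral_congr_ae (.of_forall fun x => ?_)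
    simp only [Pi.sub_apply, sub_eq_add_neg, AddCircle.toCircle_add, Circle.coe_mul]
    rfl
  have hzero : (fun x => (AddCircle.toCircle (u x) : ℂ)) =ᵐ[μ] 0 :=
    hU.coeFn_toLp.symm.trans <|
      Lp.eq_zero_iff_ae_eq_zero.mp (eq_zero_of_forall_inner_characterLp_eq_zero hΓ horth)
  obtain ⟨x, hx⟩ := hzero.exists
  exact Circle.coe_ne_zero _ hx

theorem isUnimodularEigenvalue_rotationBy_iff [NeZero μ] [μ.IsAddRightInvariant]
    (hΓ : ∀ x : G, (∀ ψ ∈ Γ, ψ x = 0) → x = 0) {α : G} {θ : UnitAddCircle} :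
    IsUnimodularEigenvalue μ (rotationBy α) θ ↔ ∃ ψ ∈ Γ, θ = ψ α := by
  refine ⟨exists_character_of_isUnimodularEigenvalue hΓ, ?_⟩
  rintro ⟨ψ, -, rfl⟩
  exact ⟨ψ, (map_continuous ψ).measurable, .of_forall fun x => map_add ψ x α⟩

end Characters

section FiniteAdeles

/-- The ring `∏ ℤ_p` of integral finite adeles, as a subring of the finite adeles. -/
noncomputable def integralFinAdeles : Subring FinAdele :=
  ⨅ p : Nat.Primes, (PadicInt.subring (p : ℕ)).comap (RestrictedProduct.evalRingHom _ p)

theorem mem_integralFinAdeles {x : FinAdele} :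
    x ∈ integralFinAdeles ↔ ∀ p : Nat.Primes, x p ∈ PadicInt.subring (p : ℕ) :=
  Subring.mem_iInf

theorem isOpen_integralFinAdeles : IsOpen (integralFinAdeles : Set FinAdele) := by
  have hopen : IsOpen {x : FinAdele | ∀ p : Nat.Primes, x p ∈ PadicInt.subring (p : ℕ)} :=
    RestrictedProduct.isOpen_forall_mem
      (Fact.out : ∀ p : Nat.Primes, IsOpen (PadicInt.subring (p : ℕ) : Set ℚ_[(p : ℕ)]))
  exact (Set.ext fun _ => mem_integralFinAdeles) ▸ hopen

/-- The diagonal embedding of `ℚ` into the finite adeles. -/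
noncomputable def finAdeleDiagonal : ℚ →+ FinAdele :=
  (AddMonoidHom.snd ℝ FinAdele).comp adeleDiagonal

theorem finAdeleDiagonal_apply (q : ℚ) (p : Nat.Primes) :
    finAdeleDiagonal q p = (q : ℚ_[(p : ℕ)]) := rfl

theorem finAdeleDiagonal_intCast_mem (n : ℤ) : finAdeleDiagonal n ∈ integralFinAdeles :=
  mem_integralFinAdeles.mpr fun p => by
    rw [finAdeleDiagonal_apply, Rat.cast_intCast]
    exact Padic.norm_int_le_one n

theorem exists_int_eq_of_finAdeleDiagonal_mem {q : ℚ} (h : finAdeleDiagonal q ∈ integralFinAdeles) :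
    ∃ n : ℤ, q = n := by
  have hden : q.den = 1 := by
    refine Nat.eq_one_iff_not_exists_prime_dvd.mpr fun p hp => ?_
    have : Fact p.Prime := ⟨hp⟩
    exact Rat.padicValuation_le_one_iff.mp
      (Padic.norm_rat_le_one_iff_padicValuation_le_one p |>.mp (mem_integralFinAdeles.mp h ⟨p, hp⟩))
  exact ⟨q.num, (Rat.coe_int_num_of_den_eq_one hden).symm⟩

theorem padic_eq_zero_of_forall_mul_norm_le_one (p : ℕ) [Fact p.Prime] {x : ℚ_[p]}
    (h : ∀ γ : ℚ, ‖(γ : ℚ_[p]) * x‖ ≤ 1) : x = 0 := by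
  by_contra hx
  obtain ⟨k, hk⟩ := pow_unbounded_of_one_lt ‖x‖⁻¹
    (by exact_mod_cast (Fact.out : p.Prime).one_lt : (1 : ℝ) < p)
  have hle := h ((p : ℚ) ^ k)⁻¹
  push_cast at hle
  rw [norm_mul, norm_inv, norm_pow, Padic.norm_p, inv_pow, inv_inv] at hle
  rw [inv_lt_iff_one_lt_mul₀ (norm_pos_iff.mpr hx)] at hk
  exact hk.not_ge hle

theorem eq_zero_of_forall_finAdeleDiagonal_mul_mem {x : FinAdele}
    (h : ∀ γ : ℚ, finAdeleDiagonal γ * x ∈ integralFinAdeles) : x = 0 :=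
  RestrictedProduct.ext _ _ fun p =>
    padic_eq_zero_of_forall_mul_norm_le_one (p : ℕ) fun γ => mem_integralFinAdeles.mp (h γ) p

/-- The sum `∑ {x_p}_p` of the `p`-adic fractional parts of a finite adele. Only finitely many
terms are nonzero, see `finite_support_padicFract`. -/
noncomputable def adeleFract (x : FinAdele) : ℚ := ∑ᶠ p : Nat.Primes, padicFract (p : ℕ) (x p)

theorem finite_support_padicFract (x : FinAdele) :
    (Function.support fun p : Nat.Primes => padicFract (p : ℕ) (x p)).Finite :=
  (finite_not_padicInt x).subset fun p hp hx => hp (padicFract_eq_zero (p : ℕ) hx)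

theorem cast_adeleFract (x : FinAdele) :
    (adeleFract x : ℝ) = ∑ᶠ p : Nat.Primes, (padicFract (p : ℕ) (x p) : ℝ) :=
  AddMonoidHom.map_finsum (Rat.castHom ℝ).toAddMonoidHom (finite_support_padicFract x)

theorem padicFract_mem_padicInt_of_ne {p q : Nat.Primes} (h : q ≠ p) (x : ℚ_[(q : ℕ)]) :
    ((padicFract q x : ℚ) : ℚ_[(p : ℕ)]) ∈ PadicInt.subring (p : ℕ) := by
  obtain ⟨⟨N, m, -, hx⟩, -⟩ := padicFract_spec q x
  have hq : ‖((q : ℕ) : ℚ_[(p : ℕ)])‖ = 1 :=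
    Padic.norm_natCast_eq_one_iff.mpr <|
      (Nat.coprime_primes p.2 q.2).mpr fun h' => h (Subtype.ext h'.symm)
  rw [hx, Rat.cast_div, Rat.cast_pow, Rat.cast_natCast, Rat.cast_natCast, PadicInt.mem_subring_iff,
    norm_div, norm_pow, hq, one_pow, div_one]
  exact Padic.norm_int_le_one (m : ℤ)

theorem sub_adeleFract_mem (x : FinAdele) :
    x - finAdeleDiagonal (adeleFract x) ∈ integralFinAdeles := by
  classical
  refine mem_integralFinAdeles.mpr fun p => ?_
  set S := insert p (finite_support_padicFract x).toFinset
  have hsum : adeleFract x = padicFract p (x p) + ∑ q ∈ S.erase p, padicFract q (x q) := by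
    rw [Finset.add_sum_erase S (fun q : Nat.Primes => padicFract q (x q))
      (Finset.mem_insert_self _ _)]
    refine finsum_eq_sum_of_support_subset _ fun q hq => ?_
    exact Finset.mem_insert_of_mem ((finite_support_padicFract x).mem_toFinset.mpr hq)
  rw [RestrictedProduct.sub_apply, finAdeleDiagonal_apply, hsum, Rat.cast_add, Rat.cast_sum,
    ← sub_sub]
  exact (PadicInt.subring (p : ℕ)).sub_mem (padicFract_spec p (x p)).2
    (Subring.sum_mem _ fun q hq => padicFract_mem_padicInt_of_ne (Finset.ne_of_mem_erase hq) _)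

-- Two rational approximations of `x` modulo `∏ ℤ_p` differ by an element of `ℚ ∩ ∏ ℤ_p = ℤ`.
theorem coe_adeleFract_eq {x : FinAdele} {r : ℚ} (h : x - finAdeleDiagonal r ∈ integralFinAdeles) :
    ((adeleFract x : ℝ) : UnitAddCircle) = ((r : ℝ) : UnitAddCircle) := by
  obtain ⟨n, hn⟩ : ∃ n : ℤ, adeleFract x - r = n := by
    refine exists_int_eq_of_finAdeleDiagonal_mem ?_
    rw [map_sub, ← sub_sub_sub_cancel_left]
    exact sub_mem h (sub_adeleFract_mem x)
  refine unitAddCircle_coe_eq_coe_iff.mpr ⟨n, ?_⟩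
  exact_mod_cast sub_eq_iff_eq_add'.mp hn

theorem coe_adeleFract_add (x y : FinAdele) :
    ((adeleFract (x + y) : ℝ) : UnitAddCircle) =
      ((adeleFract x : ℝ) : UnitAddCircle) + ((adeleFract y : ℝ) : UnitAddCircle) := by
  rw [coe_adeleFract_eq (r := adeleFract x + adeleFract y), ← AddCircle.coe_add, Rat.cast_add]
  rw [map_add, add_sub_add_comm]
  exact add_mem (sub_adeleFract_mem x) (sub_adeleFract_mem y)

end FiniteAdeles

section AdelicCharacters

/-- The standard character `x ↦ -x_∞ + ∑ {x_p}_p` of the adeles. -/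
noncomputable def adeleCharacter : Adele →+ UnitAddCircle :=
  AddMonoidHom.mk' (fun x => ((-x.1 + adeleFract x.2 : ℝ) : UnitAddCircle)) fun x y => by
    simp only [AddCircle.coe_add, Prod.fst_add, Prod.snd_add, coe_adeleFract_add, neg_add]
    abel

theorem adeleCharacter_apply (x : Adele) :
    adeleCharacter x = ((-x.1 + adeleFract x.2 : ℝ) : UnitAddCircle) := rfl

theorem adeleCharacter_eq {x : Adele} {r : ℚ}
    (h : x.2 - finAdeleDiagonal r ∈ integralFinAdeles) :
    adeleCharacter x = ((-x.1 + r : ℝ) : UnitAddCircle) := by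
  rw [adeleCharacter_apply, AddCircle.coe_add, coe_adeleFract_eq h, ← AddCircle.coe_add]

theorem adeleCharacter_adeleDiagonal (q : ℚ) : adeleCharacter (adeleDiagonal q) = 0 := by
  rw [adeleCharacter_eq (r := q)]
  · exact congrArg _ (neg_add_cancel (q : ℝ))
  · exact (sub_self (finAdeleDiagonal q)).symm ▸ zero_mem _

-- Near `0` the finite part is integral, so the character is `x ↦ -x_∞` there.
theorem continuous_adeleCharacter : Continuous adeleCharacter := by
  refine continuous_of_continuousAt_zero adeleCharacter ?_
  have hnhds : ∀ᶠ x : Adele in nhds 0, x.2 ∈ integralFinAdeles :=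
    (isOpen_integralFinAdeles.preimage continuous_snd).mem_nhds (zero_mem integralFinAdeles)
  have hcont : Continuous fun x : Adele => ((-x.1 : ℝ) : UnitAddCircle) :=
    (AddCircle.continuous_mk' 1).comp continuous_fst.neg
  refine hcont.continuousAt.congr (hnhds.mono fun x hx => ?_)
  rw [adeleCharacter_eq (r := 0) (by rwa [map_zero, sub_zero]), Rat.cast_zero, add_zero]

theorem exists_rat_fst_eq_of_adeleCharacter_eq_zero {x : Adele} (h : adeleCharacter x = 0) :
    ∃ q : ℚ, x.1 = q := by
  obtain ⟨n, hn⟩ := unitAddCircle_coe_eq_zero_iff.mp h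
  refine ⟨adeleFract x.2 - n, ?_⟩
  push_cast
  linarith

theorem snd_mem_integralFinAdeles_of_adeleCharacter_eq_zero {x : Adele} (hx : x.1 = 0)
    (h : adeleCharacter x = 0) : x.2 ∈ integralFinAdeles := by
  obtain ⟨n, hn⟩ := unitAddCircle_coe_eq_zero_iff.mp h
  rw [hx, neg_zero, zero_add] at hn
  have hfract : adeleFract x.2 = n := by exact_mod_cast hn
  rw [← sub_add_cancel x.2 (finAdeleDiagonal (adeleFract x.2))]
  exact add_mem (sub_adeleFract_mem x.2) (hfract ▸ finAdeleDiagonal_intCast_mem n)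

theorem eq_zero_of_forall_adeleCharacter_mul_eq_zero {x : Adele} (hx : x.1 = 0)
    (h : ∀ γ : ℚ, adeleCharacter (adeleDiagonal γ * x) = 0) : x = 0 :=
  Prod.ext hx <| eq_zero_of_forall_finAdeleDiagonal_mul_mem fun γ =>
    snd_mem_integralFinAdeles_of_adeleCharacter_eq_zero
      (by rw [Prod.fst_mul, hx, mul_zero]) (h γ)

theorem adeleDiagonal_one : adeleDiagonal 1 = 1 :=
  Prod.ext Rat.cast_one (RestrictedProduct.ext _ _ fun _ => Rat.cast_one)

theorem adeleDiagonal_mul (q r : ℚ) :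
    adeleDiagonal (q * r) = adeleDiagonal q * adeleDiagonal r :=
  Prod.ext (Rat.cast_mul q r) (RestrictedProduct.ext _ _ fun _ => Rat.cast_mul q r)

theorem mem_range_adeleDiagonal_of_forall_adeleCharacter_mul_eq_zero {x : Adele}
    (h : ∀ γ : ℚ, adeleCharacter (adeleDiagonal γ * x) = 0) : x ∈ adeleDiagonal.range := by
  obtain ⟨q, hq⟩ := exists_rat_fst_eq_of_adeleCharacter_eq_zero (x := x) (by
    rw [← one_mul x, ← adeleDiagonal_one, h])
  refine ⟨q, (sub_eq_zero.mp ?_).symm⟩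
  refine eq_zero_of_forall_adeleCharacter_mul_eq_zero (sub_eq_zero.mpr hq) fun γ => ?_
  rw [mul_sub, map_sub, h, ← adeleDiagonal_mul, adeleCharacter_adeleDiagonal, sub_zero]

/-- The character `x ↦ -γ x_∞ + ∑ {γ x_p}_p` of the adelic torus. -/
noncomputable def torusCharacter : ℚ →+ (AdelicTorus →ₜ+ UnitAddCircle) :=
  AddMonoidHom.mk' (fun γ =>
    { toAddMonoidHom := QuotientAddGroup.lift _
        (adeleCharacter.comp (AddMonoidHom.mulLeft (adeleDiagonal γ))) (by
          rintro - ⟨q, rfl⟩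
          rw [AddMonoidHom.mem_ker, AddMonoidHom.comp_apply, AddMonoidHom.coe_mulLeft,
            ← adeleDiagonal_mul, adeleCharacter_adeleDiagonal])
      continuous_toFun :=
        (continuous_adeleCharacter.comp (continuous_const_mul _)).quotient_lift _ })
    fun γ δ => by
      ext x
      obtain ⟨a, rfl⟩ := QuotientAddGroup.mk_surjective x
      change adeleCharacter (adeleDiagonal (γ + δ) * a) =
        adeleCharacter (adeleDiagonal γ * a) + adeleCharacter (adeleDiagonal δ * a)
      rw [map_add, add_mul, map_add]

theorem torusCharacter_mk (γ : ℚ) (x : Adele) :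
    torusCharacter γ (QuotientAddGroup.mk x) = adeleCharacter (adeleDiagonal γ * x) := rfl

theorem torusCharacter_mk_eq (γ : ℚ) (x : Adele) :
    torusCharacter γ (QuotientAddGroup.mk x) =
      ((-(γ : ℝ) * x.1
        + ∑ᶠ p : Nat.Primes, (padicFract (p : ℕ) ((γ : ℚ_[(p : ℕ)]) * x.2 p) : ℝ) : ℝ) :
          UnitAddCircle) := by
  rw [torusCharacter_mk, adeleCharacter_apply, cast_adeleFract, Prod.fst_mul, neg_mul]
  rfl

theorem eq_zero_of_forall_torusCharacter_eq_zero (x : AdelicTorus)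
    (h : ∀ ψ ∈ torusCharacter.range, ψ x = 0) : x = 0 := by
  obtain ⟨a, rfl⟩ := QuotientAddGroup.mk_surjective x
  exact (QuotientAddGroup.eq_zero_iff _).mpr <|
    mem_range_adeleDiagonal_of_forall_adeleCharacter_mul_eq_zero fun γ => h _ ⟨γ, rfl⟩

end AdelicCharacters

instance adelicHaar_isAddHaarMeasure : adelicHaar.IsAddHaarMeasure :=
  inferInstanceAs (Measure.addHaarMeasure (⊤ : PositiveCompacts AdelicTorus)).IsAddHaarMeasure

instance adelicHaar_regular : adelicHaar.Regular :=
  inferInstanceAs (Measure.addHaarMeasure (⊤ : PositiveCompacts AdelicTorus)).Regular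

instance adelicHaar_isProbabilityMeasure : IsProbabilityMeasure adelicHaar :=
  ⟨Measure.addHaarMeasure_self (K₀ := (⊤ : PositiveCompacts AdelicTorus))⟩

theorem theorem1p1_general (α : Adele) :
    boundedRemainderVolumes adelicHaar (QuotientAddGroup.mk α : AdelicTorus) =
      {v : ℝ | 0 ≤ v ∧ ∃ (γ : ℚ) (n : ℤ),
        v = -(γ : ℝ) * α.1
          + ∑ᶠ p : Nat.Primes, (padicFract (p : ℕ) ((γ : ℚ_[(p : ℕ)]) * α.2 p) : ℝ) + n} := by
  ext v
  rw [mem_boundedRemainderVolumes_iff_isUnimodularEigenvalue,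
    isUnimodularEigenvalue_rotationBy_iff eq_zero_of_forall_torusCharacter_eq_zero]
  simp only [AddMonoidHom.mem_range, exists_exists_eq_and, torusCharacter_mk_eq,
    unitAddCircle_coe_eq_coe_iff, mem_ofPred_eq]

theorem theorem1p1 (α : Adele) (hα : Irrational α.1) :
    boundedRemainderVolumes adelicHaar (QuotientAddGroup.mk α : AdelicTorus) =
      {v : ℝ | 0 ≤ v ∧ ∃ (γ : ℚ) (n : ℤ),
        v = -(γ : ℝ) * α.1
          + ∑ᶠ p : Nat.Primes, (padicFract (p : ℕ) ((γ : ℚ_[(p : ℕ)]) * α.2 p) : ℝ) + n} :=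
  theorem1p1_general α
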